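/- For a finite group $G$ and integers $(a_g)_{g\in G}$ let $\mathscr{D}_G\big((a_g)_{g\in G}\big)=\det\big(a_{gh^{-1}}\big)_{g,h\in G}$ (rows indexed by $g$, columns by $h$) be the integer group determinant. Let $H_3$ be the Heisenberg group over $\mathbb{Z}/3\mathbb{Z}$, i.e. the group of order $27$ of matrices $\begin{pmatrix}1&a&c\\0&1&b\\0&0&1\end{pmatrix}$ with $a,b,c\in\mathbb{Z}/3\mathbb{Z}$ under matrix multiplication, and let $\mathscr{S}(H_3)=\{\mathscr{D}_{H_3}((a_g)_{g\in H_3}) : a_g\in\mathbb{Z}\text{ for all }g\in H_3\}$. Let $\mathscr{S}_1(H_3)$ be the set of elements of $\mathscr{S}(H_3)$ that are coprime to $3$, and $\mathscr{S}_0(H_3)$ the set of elements of $\mathscr{S}(H_3)$ that are multiples of $3$. Then $$\mathscr{S}_1(H_3)=\{m\in\mathbb{Z} : m\equiv\pm1 \bmod 27\},\qquad \mathscr{S}_0(H_3)=3^{12}\mathbb{Z}.$$ -/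

import Mathlib

/-- The Heisenberg group over `R`: the subgroup of `SL₃(R)` consisting of the matrices
`(1, a, c; 0, 1, b; 0, 0, 1)` with `a, b, c ∈ R`. -/
def heisenberg (R : Type*) [CommRing R] : Subgroup (Matrix.SpecialLinearGroup (Fin 3) R) where
  carrier := {g | ∃ a b c : R, (g : Matrix (Fin 3) (Fin 3) R) = !![1, a, c; 0, 1, b; 0, 0, 1]}
  one_mem' := ⟨0, 0, 0, by ext i j; fin_cases i <;> fin_cases j <;> simp⟩
  mul_mem' := by
    rintro g h ⟨a, b, c, hg⟩ ⟨a', b', c', hh⟩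
    refine ⟨a' + a, b' + b, c' + a * b' + c, ?_⟩
    rw [Matrix.SpecialLinearGroup.coe_mul, hg, hh]
    ext i j
    fin_cases i <;> fin_cases j <;> simp [Matrix.mul_apply, Fin.sum_univ_three]
  inv_mem' := by
    rintro g ⟨a, b, c, hg⟩
    refine ⟨-a, -b, a * b - c, ?_⟩
    rw [Matrix.SpecialLinearGroup.coe_inv, hg, Matrix.adjugate_fin_three]
    ext i j
    fin_cases i <;> fin_cases j <;> simp

/-- Elements of the Heisenberg group are given by their three entries `a, b, c`. -/
def heisenbergEquiv (R : Type*) [CommRing R] : heisenberg R ≃ R × R × R where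
  toFun g := (g.1.1 0 1, g.1.1 1 2, g.1.1 0 2)
  invFun t := ⟨⟨!![1, t.1, t.2.2; 0, 1, t.2.1; 0, 0, 1], by simp [Matrix.det_fin_three]⟩,
    t.1, t.2.1, t.2.2, rfl⟩
  left_inv := by
    rintro ⟨g, a, b, c, hg⟩
    apply Subtype.ext
    apply Subtype.ext
    change _ = (g : Matrix (Fin 3) (Fin 3) R)
    simp [hg]
  right_inv t := by simp

instance heisenbergFintype (R : Type*) [CommRing R] [Fintype R] : Fintype (heisenberg R) :=
  Fintype.ofEquiv (R × R × R) (heisenbergEquiv R).symm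

instance heisenbergDecidableEq (R : Type*) [CommRing R] [DecidableEq R] :
    DecidableEq (heisenberg R) :=
  (heisenbergEquiv R).decidableEq

/-- The group determinant `det (a_{g h⁻¹})`, rows indexed by `g` and columns by `h`,
of a family of integers `(a_g)` indexed by a finite group `G`. -/
def groupDet (G : Type*) [Group G] [Fintype G] [DecidableEq G] (a : G → ℤ) : ℤ :=
  (Matrix.of fun g h : G => a (g * h⁻¹)).det

/-- The set of all integer group determinants of `G`. -/
def groupDetValues (G : Type*) [Group G] [Fintype G] [DecidableEq G] : Set ℤ :=
  {m | ∃ a : G → ℤ, groupDet G a = m}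

/-- The integer group determinants of `G` that are multiples of `p`. -/
def groupDetValuesZero (p : ℕ) (G : Type*) [Group G] [Fintype G] [DecidableEq G] : Set ℤ :=
  {m | m ∈ groupDetValues G ∧ (p : ℤ) ∣ m}

/-- The integer group determinants of `G` that are coprime to `p`. -/
def groupDetValuesOne (p : ℕ) (G : Type*) [Group G] [Fintype G] [DecidableEq G] : Set ℤ :=
  {m | m ∈ groupDetValues G ∧ IsCoprime m (p : ℤ)}

/-! A Fourier transform along the abelian normal subgroup `b = 0` splits the determinant as
`abelianForm b * N ^ 3` (`groupDet_heisenberg`). Here `b` sums the `a_g` over cosets of the centre,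
and `N` is the norm from `ℤ[ω]` of a 3×3 determinant: two conjugate representations of degree 3,
each occurring three times.

Let `s` be the total. Since `a ↦ a ^ ω`-type twists vanish modulo `π = ω - 1`, expanding the cubic
form modulo `π ^ 3` gives `N` modulo 9 in terms of `b`. Combined with the expansion of
`abelianForm`, the terms of order 9 cancel, so the determinant is `s ^ 27` modulo 27
(`groupDet_congr_pow`), which is 0 or ±1. If `3 ∣ s`, then `3 ^ 6` divides both `abelianForm b` and
`N ^ 3` (`pow_twelve_dvd`).

Conversely, adding `m` to every `a_g` changes only the trivial character's factor, from `s` to `s +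
27 * m` (`groupDet_shifted`); a few explicit arrays and a change of sign then give every value. -/

/-! ### Fourier transform of the group determinant -/

open Matrix in
/-- Fourier transform of a block matrix whose blocks are circulant over a finite ring `Z`. -/
theorem Matrix.det_blockCirculant {R Z n : Type*} [CommRing R] [CommRing Z] [Fintype Z]
    [DecidableEq Z] [Fintype n] [DecidableEq n] (ψ : AddChar Z R)
    (hψ : ∀ k : Z, ∑ c, ψ (k * c) = if k = 0 then (Fintype.card Z : R) else 0)
    (hZ : (Fintype.card Z : R) ∈ nonZeroDivisors R) (N : n → n → Z → R) :
    (of fun x y : n × Z => N x.1 y.1 (x.2 - y.2)).det =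
      ∏ k, (of fun i j => ∑ c, N i j c * ψ (k * c)).det := by
  classical
  set F : Matrix Z Z R := of fun c k => ψ (-(k * c)) with hF
  have hFF : F * (of fun k c => ψ (k * c)) = (Fintype.card Z : R) • (1 : Matrix Z Z R) := by
    ext c c'
    simp only [hF, Matrix.mul_apply, of_apply, ← AddChar.map_add_eq_mul, Matrix.smul_apply,
      Matrix.one_apply, smul_eq_mul, mul_ite, mul_one, mul_zero]
    rw [Finset.sum_congr rfl fun k _ => by rw [show -(k * c) + k * c' = (c' - c) * k by ring],
      hψ]
    simp only [sub_eq_zero, eq_comm]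
  -- `F.det` divides a power of the cardinality of `Z`, so it can be cancelled although `F` need not
  -- be invertible over `R`.
  have hdet : F.det ∈ nonZeroDivisors R := by
    have h := congrArg Matrix.det hFF
    rw [det_mul, det_smul, det_one, mul_one] at h
    exact (mul_mem_nonZeroDivisors.mp (h ▸ pow_mem hZ _)).1
  have hP : (of fun x y : n × Z => N x.1 y.1 (x.2 - y.2)) * kroneckerMap (· * ·) (1 : Matrix n n R) F
      = kroneckerMap (· * ·) (1 : Matrix n n R) F *
        blockDiagonal (fun k => of fun i j => ∑ c, N i j c * ψ (k * c)) := by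
    ext ⟨i, c⟩ ⟨j, k⟩
    simp only [Matrix.mul_apply, Fintype.sum_prod_type, of_apply, kroneckerMap_apply,
      Matrix.one_apply, blockDiagonal_apply, hF, ite_mul, one_mul, zero_mul, mul_ite, mul_zero]
    simp only [Finset.sum_ite_irrel, Finset.sum_const_zero, Finset.sum_ite_eq,
      Finset.sum_ite_eq', Finset.mem_univ, if_true]
    rw [Finset.mul_sum, ← Equiv.sum_comp (Equiv.subLeft c)]
    refine Finset.sum_congr rfl fun t _ => ?_
    rw [Equiv.subLeft_apply, sub_sub_cancel, mul_left_comm, ← AddChar.map_add_eq_mul]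
    congr 2
    ring
  have h := congrArg Matrix.det hP
  rw [det_mul, det_mul, det_blockDiagonal, mul_comm] at h
  refine (mul_cancel_left_mem_nonZeroDivisors ?_).mp h
  have hk := det_kronecker (1 : Matrix n n R) F
  rw [kroneckerMap] at *
  rw [show (of fun (i : n × Z) (j : n × Z) => (1 : Matrix n n R) i.1 j.1 * F i.2 j.2).det = _ from hk,
    det_one, one_pow, one_mul]
  exact pow_mem hdet _

/-- Fourier transform of the group determinant of `heisenberg (ZMod 3)` along the centre and then
along the first coordinate. -/
theorem groupDet_heisenberg_eq_prod {R : Type*} [CommRing R] (ψ : AddChar (ZMod 3) R)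
    (hψ : ∀ k : ZMod 3, ∑ c, ψ (k * c) = if k = 0 then (Fintype.card (ZMod 3) : R) else 0)
    (hZ : (Fintype.card (ZMod 3) : R) ∈ nonZeroDivisors R) (A : ZMod 3 → ZMod 3 → ZMod 3 → ℤ) :
    ((groupDet (heisenberg (ZMod 3)) (fun g => A (g.1.1 0 1) (g.1.1 1 2) (g.1.1 0 2)) : ℤ) : R) =
      ∏ k, ∏ j, (Matrix.of fun r s : ZMod 3 =>
        ∑ t, ∑ c, (A t (r - s) c : R) * ψ (k * c + (j + k * s) * t)).det := by
  -- With the order `((b, a), c)`, the twist `(a - a') * b'` in `g * h⁻¹` depends on `a` and `a'`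
  -- only through `a - a'`, so the blocks remain circulant in `a` after the transform in `c`.
  let e : heisenberg (ZMod 3) ≃ (ZMod 3 × ZMod 3) × ZMod 3 :=
    (heisenbergEquiv (ZMod 3)).trans
      ((Equiv.prodAssoc _ _ _).symm.trans ((Equiv.prodComm _ _).prodCongr (Equiv.refl _)))
  rw [groupDet, Int.cast_det, ← Matrix.det_reindex_self e]
  have h1 : Matrix.reindex e e ((Matrix.of fun g h : heisenberg (ZMod 3) =>
      A ((g * h⁻¹).1.1 0 1) ((g * h⁻¹).1.1 1 2) ((g * h⁻¹).1.1 0 2)).map (fun x : ℤ => (x : R))) =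
      Matrix.of fun x y : (ZMod 3 × ZMod 3) × ZMod 3 =>
        (fun (u v : ZMod 3 × ZMod 3) c =>
          (A (u.2 - v.2) (u.1 - v.1) (c - (u.2 - v.2) * v.1) : R)) x.1 y.1 (x.2 - y.2) := by
    ext ⟨⟨b, a⟩, c⟩ ⟨⟨b', a'⟩, c'⟩
    simp [e, heisenbergEquiv, Matrix.SpecialLinearGroup.coe_inv, Matrix.adjugate_fin_three,
      Matrix.mul_apply, Fin.sum_univ_three]
    ring_nf
  refine (congrArg Matrix.det h1).trans ?_
  refine (Matrix.det_blockCirculant ψ hψ hZ (fun (u v : ZMod 3 × ZMod 3) c =>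
    (A (u.2 - v.2) (u.1 - v.1) (c - (u.2 - v.2) * v.1) : R))).trans ?_
  refine Finset.prod_congr rfl fun k _ => ?_
  refine (Matrix.det_blockCirculant ψ hψ hZ (fun r s t => ∑ c, (A t (r - s) (c - t * s) : R) *
    ψ (k * c))).trans ?_
  refine Finset.prod_congr rfl fun j _ => ?_
  congr 1
  ext r s
  simp only [Matrix.of_apply, Finset.sum_mul]
  refine Finset.sum_congr rfl fun t _ => ?_
  -- Translating `c` moves the twist out of `A` and into the character, as the factor `ψ (k * s *
  -- t)`.
  rw [← Equiv.sum_comp (Equiv.addRight (t * s))]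
  refine Finset.sum_congr rfl fun c _ => ?_
  rw [Equiv.coe_addRight, add_sub_cancel_right, mul_assoc, ← AddChar.map_add_eq_mul]
  congr 2
  ring

theorem ZMod.sum_univ_three {M : Type*} [AddCommMonoid M] (f : ZMod 3 → M) :
    ∑ t, f t = f 0 + f 1 + f 2 := Fin.sum_univ_three f

theorem ZMod.eq_zero_or_one_or_two (k : ZMod 3) : k = 0 ∨ k = 1 ∨ k = 2 := by
  revert k
  decide

theorem ZMod.prod_univ_three {M : Type*} [CommMonoid M] (f : ZMod 3 → M) :
    ∏ t, f t = f 0 * f 1 * f 2 := Fin.prod_univ_three f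

theorem ZMod.det_three {R : Type*} [CommRing R] (f : ZMod 3 → ZMod 3 → R) :
    (Matrix.of f).det = f 0 0 * f 1 1 * f 2 2 - f 0 0 * f 1 2 * f 2 1
      - f 0 1 * f 1 0 * f 2 2 + f 0 1 * f 1 2 * f 2 0
      + f 0 2 * f 1 0 * f 2 1 - f 0 2 * f 1 1 * f 2 0 := Matrix.det_fin_three _

/-! ### Determinants of the irreducible representations -/

section Forms

variable {R : Type*} [CommRing R]

/-- The second elementary symmetric polynomial in three variables. -/
def symm2 (p q r : R) : R := p * q + q * r + r * p

/-- The sum of all entries of a `3 × 3` array. -/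
def total (b : ZMod 3 → ZMod 3 → R) : R :=
  b 0 0 + b 1 0 + b 2 0 + (b 0 1 + b 1 1 + b 2 1) + (b 0 2 + b 1 2 + b 2 2)

/-- `symm2` of the sums of `b` over the lines `j = const`. -/
def lineForm₁ (b : ZMod 3 → ZMod 3 → R) : R :=
  symm2 (b 0 0 + b 1 0 + b 2 0) (b 0 1 + b 1 1 + b 2 1) (b 0 2 + b 1 2 + b 2 2)

/-- `symm2` of the sums of `b` over the lines `i = const`. -/
def lineForm₂ (b : ZMod 3 → ZMod 3 → R) : R :=
  symm2 (b 0 0 + b 0 1 + b 0 2) (b 1 0 + b 1 1 + b 1 2) (b 2 0 + b 2 1 + b 2 2)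

/-- `symm2` of the sums of `b` over the lines `i + j = const`. -/
def lineForm₃ (b : ZMod 3 → ZMod 3 → R) : R :=
  symm2 (b 0 0 + b 1 2 + b 2 1) (b 0 1 + b 1 0 + b 2 2) (b 0 2 + b 1 1 + b 2 0)

/-- `symm2` of the sums of `b` over the lines `i + 2 j = const`. -/
def lineForm₄ (b : ZMod 3 → ZMod 3 → R) : R :=
  symm2 (b 0 0 + b 1 1 + b 2 2) (b 0 2 + b 1 0 + b 2 1) (b 0 1 + b 1 2 + b 2 0)

/-- The group determinant of `(ZMod 3)²` in factored form. -/
def abelianForm (b : ZMod 3 → ZMod 3 → R) : R :=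
  total b * ((total b ^ 2 - 3 * lineForm₁ b) * (total b ^ 2 - 3 * lineForm₂ b) *
    (total b ^ 2 - 3 * lineForm₃ b) * (total b ^ 2 - 3 * lineForm₄ b))

/-- The determinant of the three-dimensional representation of the Heisenberg group in which the
centre acts through `w`; here `c i j` is the Fourier coefficient over the coset of the centre with
coordinates `(i, j)`. -/
def cubicForm (w : R) (c : ZMod 3 → ZMod 3 → R) : R :=
  let f : ZMod 3 → ZMod 3 → R := fun j t =>
    c 0 j + c 1 j * w ^ t.val + c 2 j * w ^ (2 * t).val
  f 0 0 * f 0 1 * f 0 2 + f 1 0 * f 1 1 * f 1 2 + f 2 0 * f 2 1 * f 2 2 -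
    (f 0 0 * f 1 1 * f 2 2 + f 1 0 * f 2 1 * f 0 2 + f 2 0 * f 0 1 * f 1 2)

theorem circulant_factor {w : R} (hw : w ^ 2 + w + 1 = 0) (x y z : R) :
    x ^ 3 + y ^ 3 + z ^ 3 - 3 * x * y * z =
      (x + y + z) * (x + y * w + z * w ^ 2) * (x + y * w ^ 2 + z * w) := by
  have h3 : w ^ 3 = 1 := by linear_combination (w - 1) * hw
  have h : (x + y * w + z * w ^ 2) * (x + y * w ^ 2 + z * w) =
      x ^ 2 + y ^ 2 + z ^ 2 - x * y - y * z - z * x := by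
    linear_combination (x * y + z * x + y * z * w ^ 2 - y * z * w + y * z) * hw +
      (y ^ 2 + z ^ 2) * h3
  linear_combination -(x + y + z) * h

theorem eisenstein_norm {w : R} (hw : w ^ 2 + w + 1 = 0) (p q r : R) :
    (p + q * w + r * w ^ 2) * (p + q * w ^ 2 + r * w) = (p + q + r) ^ 2 - 3 * symm2 p q r := by
  have h3 : w ^ 3 = 1 := by linear_combination (w - 1) * hw
  rw [symm2]
  linear_combination (p * q + r * p + q * r * w ^ 2 - q * r * w + q * r) * hw +
      (q ^ 2 + r ^ 2) * h3

/-- The nine linear factors are the character sums of `(ZMod 3)²`. The eight nontrivial ones form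
four conjugate pairs, one for each direction of lines, and `eisenstein_norm` evaluates each pair. -/
theorem prod_circulant {w : R} (hw : w ^ 2 + w + 1 = 0) (b : ZMod 3 → ZMod 3 → R) (x y z : ℕ → R)
    (hx : ∀ j, x j = b 0 0 + b 1 0 * w ^ j + b 2 0 * w ^ (2 * j))
    (hy : ∀ j, y j = b 0 1 + b 1 1 * w ^ j + b 2 1 * w ^ (2 * j))
    (hz : ∀ j, z j = b 0 2 + b 1 2 * w ^ j + b 2 2 * w ^ (2 * j)) :
    ((x 0 ^ 3 + y 0 ^ 3 + z 0 ^ 3 - 3 * x 0 * y 0 * z 0) *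
      (x 1 ^ 3 + y 1 ^ 3 + z 1 ^ 3 - 3 * x 1 * y 1 * z 1) *
      (x 2 ^ 3 + y 2 ^ 3 + z 2 ^ 3 - 3 * x 2 * y 2 * z 2)) = abelianForm b := by
  have h3 : w ^ 3 = 1 := by linear_combination (w - 1) * hw
  have h4 : w ^ 4 = w := by linear_combination w * h3
  have h6 : w ^ 6 = 1 := by linear_combination (w ^ 3 + 1) * h3
  have h5 : w ^ 5 = w ^ 2 := by linear_combination w ^ 2 * h3
  simp only [circulant_factor hw]
  have e1 := eisenstein_norm hw (b 0 0 + b 1 0 + b 2 0) (b 0 1 + b 1 1 + b 2 1)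
    (b 0 2 + b 1 2 + b 2 2)
  have e2 := eisenstein_norm hw (b 0 0 + b 0 1 + b 0 2) (b 1 0 + b 1 1 + b 1 2)
    (b 2 0 + b 2 1 + b 2 2)
  have e3 := eisenstein_norm hw (b 0 0 + b 1 2 + b 2 1) (b 0 1 + b 1 0 + b 2 2)
    (b 0 2 + b 1 1 + b 2 0)
  have e4 := eisenstein_norm hw (b 0 0 + b 1 1 + b 2 2) (b 0 2 + b 1 0 + b 2 1)
    (b 0 1 + b 1 2 + b 2 0)
  have t1 : b 0 0 + b 1 0 + b 2 0 + (b 0 1 + b 1 1 + b 2 1) + (b 0 2 + b 1 2 + b 2 2) = total b :=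
    rfl
  have t2 : b 0 0 + b 0 1 + b 0 2 + (b 1 0 + b 1 1 + b 1 2) + (b 2 0 + b 2 1 + b 2 2) = total b := by
    rw [total]; ring
  have t3 : b 0 0 + b 1 2 + b 2 1 + (b 0 1 + b 1 0 + b 2 2) + (b 0 2 + b 1 1 + b 2 0) = total b := by
    rw [total]; ring
  have t4 : b 0 0 + b 1 1 + b 2 2 + (b 0 2 + b 1 0 + b 2 1) + (b 0 1 + b 1 2 + b 2 0) = total b := by
    rw [total]; ring
  rw [t1] at e1; rw [t2] at e2; rw [t3] at e3; rw [t4] at e4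
  rw [abelianForm, lineForm₁, lineForm₂, lineForm₃, lineForm₄, ← e1, ← e2, ← e3, ← e4]
  have f00 : x 0 + y 0 + z 0 = total b := by rw [hx, hy, hz, total]; ring
  have f01 : x 0 + y 0 * w + z 0 * w ^ 2 = b 0 0 + b 1 0 + b 2 0 + (b 0 1 + b 1 1 + b 2 1) * w +
      (b 0 2 + b 1 2 + b 2 2) * w ^ 2 := by rw [hx, hy, hz]; ring
  have f02 : x 0 + y 0 * w ^ 2 + z 0 * w = b 0 0 + b 1 0 + b 2 0 + (b 0 1 + b 1 1 + b 2 1) * w ^ 2 +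
      (b 0 2 + b 1 2 + b 2 2) * w := by rw [hx, hy, hz]; ring
  have f10 : x 1 + y 1 + z 1 = b 0 0 + b 0 1 + b 0 2 + (b 1 0 + b 1 1 + b 1 2) * w +
      (b 2 0 + b 2 1 + b 2 2) * w ^ 2 := by rw [hx, hy, hz]; ring
  have f20 : x 2 + y 2 + z 2 = b 0 0 + b 0 1 + b 0 2 + (b 1 0 + b 1 1 + b 1 2) * w ^ 2 +
      (b 2 0 + b 2 1 + b 2 2) * w := by
    rw [hx, hy, hz]; linear_combination (b 2 0 + b 2 1 + b 2 2) * h4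
  have f11 : x 1 + y 1 * w + z 1 * w ^ 2 = b 0 0 + b 1 2 + b 2 1 + (b 0 1 + b 1 0 + b 2 2) * w +
      (b 0 2 + b 1 1 + b 2 0) * w ^ 2 := by
    rw [hx, hy, hz]; linear_combination (b 2 1 + b 1 2) * h3 + b 2 2 * h4
  have f22 : x 2 + y 2 * w ^ 2 + z 2 * w = b 0 0 + b 1 2 + b 2 1 +
      (b 0 1 + b 1 0 + b 2 2) * w ^ 2 + (b 0 2 + b 1 1 + b 2 0) * w := by
    rw [hx, hy, hz]
    linear_combination b 2 0 * h4 + b 1 1 * h4 + b 2 1 * h6 + b 1 2 * h3 + b 2 2 * h5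
  have f12 : x 1 + y 1 * w ^ 2 + z 1 * w = b 0 0 + b 1 1 + b 2 2 + (b 0 2 + b 1 0 + b 2 1) * w +
      (b 0 1 + b 1 2 + b 2 0) * w ^ 2 := by
    rw [hx, hy, hz]; linear_combination b 1 1 * h3 + b 2 1 * h4 + b 2 2 * h3
  have f21 : x 2 + y 2 * w + z 2 * w ^ 2 = b 0 0 + b 1 1 + b 2 2 +
      (b 0 2 + b 1 0 + b 2 1) * w ^ 2 + (b 0 1 + b 1 2 + b 2 0) * w := by
    rw [hx, hy, hz]
    linear_combination b 2 0 * h4 + b 1 1 * h3 + b 2 1 * h5 + b 1 2 * h4 + b 2 2 * h6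
  rw [f00, f01, f02, f10, f20, f11, f22, f12, f21]
  ac_rfl

end Forms

/-! ### Eisenstein integers and the cubic character -/

/-- The ring of Eisenstein integers `ℤ[ω]`, with `ω² = -1 - ω`. -/
abbrev Eisenstein : Type := QuadraticAlgebra ℤ (-1) (-1)

namespace Eisenstein

/-- The primitive cube root of unity. -/
def w : Eisenstein := ⟨0, 1⟩

theorem w_sq_add : w ^ 2 + w + 1 = 0 := by decide

theorem w_pow_three : w ^ 3 = 1 := by decide

theorem three_mem_nonZeroDivisors :
    (Fintype.card (ZMod 3) : Eisenstein) ∈ nonZeroDivisors Eisenstein := by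
  have := (QuadraticAlgebra.algebraMap_mem_nonZeroDivisors_iff (R := ℤ) (a := -1) (b := -1)
    (r := 3)).mpr (by simp)
  simpa [ZMod.card] using this

/-- The additive character `t ↦ ω ^ t` of `ZMod 3`. -/
noncomputable def char : AddChar (ZMod 3) Eisenstein := AddChar.zmodChar 3 w_pow_three

theorem char_zero : char 0 = 1 := AddChar.map_zero_eq_one _

theorem char_one : char 1 = w := by
  rw [char, AddChar.zmodChar_apply, show (1 : ZMod 3).val = 1 from rfl, pow_one]

theorem char_two : char 2 = w ^ 2 := by
  rw [char, AddChar.zmodChar_apply, show (2 : ZMod 3).val = 2 from rfl]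

theorem sum_char (k : ZMod 3) :
    ∑ c, char (k * c) = if k = 0 then (Fintype.card (ZMod 3) : Eisenstein) else 0 := by
  have h2 : (2 * 2 : ZMod 3) = 1 := by decide
  rw [ZMod.sum_univ_three]
  obtain rfl | rfl | rfl := ZMod.eq_zero_or_one_or_two k
  · simp only [zero_mul, char_zero, ZMod.card, if_true]
    norm_num
  · simp only [mul_zero, one_mul, char_zero, char_one, char_two]
    decide
  · simp only [mul_zero, mul_one, h2, char_zero, char_one, char_two]
    decide

theorem star_char (x : ZMod 3) : star (char x) = char (2 * x) := by
  have h2 : (2 * 2 : ZMod 3) = 1 := by decide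
  obtain rfl | rfl | rfl := ZMod.eq_zero_or_one_or_two x
  · simp only [mul_zero, char_zero]; decide
  · simp only [mul_one, char_one, char_two]; decide
  · simp only [h2, char_one, char_two]; decide

/-- The Fourier coefficients of `A` along the last coordinate at the character `t ↦ ω ^ t`. -/
def coeff (A : ZMod 3 → ZMod 3 → ZMod 3 → ℤ) (i j : ZMod 3) : Eisenstein :=
  ⟨A i j 0 - A i j 2, A i j 1 - A i j 2⟩

theorem coeff_eq_sum (A : ZMod 3 → ZMod 3 → ZMod 3 → ℤ) (i j : ZMod 3) :
    coeff A i j = ∑ c, (A i j c : Eisenstein) * char c := by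
  rw [ZMod.sum_univ_three, char_zero, char_one, char_two]
  ext <;> simp [coeff, w, pow_two] <;> ring

end Eisenstein

/-! ### Factorization of the Heisenberg determinant -/

open Eisenstein

/-- The factorization of the integer group determinant of `heisenberg (ZMod 3)`. -/
theorem groupDet_heisenberg (A : ZMod 3 → ZMod 3 → ZMod 3 → ℤ) :
    groupDet (heisenberg (ZMod 3)) (fun g => A (g.1.1 0 1) (g.1.1 1 2) (g.1.1 0 2)) =
      abelianForm (fun i j => A i j 0 + A i j 1 + A i j 2) *
        (cubicForm w (coeff A)).norm ^ 3 := by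
  apply QuadraticAlgebra.algebraMap_injective (a := -1) (b := -1)
  rw [map_mul, map_pow, QuadraticAlgebra.algebraMap_norm_eq_mul_star]
  refine (groupDet_heisenberg_eq_prod char sum_char three_mem_nonZeroDivisors A).trans ?_
  set G : ZMod 3 → ZMod 3 → Eisenstein := fun k j => (Matrix.of fun r s : ZMod 3 =>
        ∑ t, ∑ c, (A t (r - s) c : Eisenstein) * char (k * c + (j + k * s) * t)).det with hG
  -- For `k ≠ 0`, translating rows and columns by `j / k` absorbs `j`; the three equal factors
  -- produce the cube.
  have shift (k j m : ZMod 3) (h : k * m = j) : G k j = G k 0 := by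
    rw [hG]
    simp only
    rw [← Matrix.det_reindex_self (Equiv.addRight m)]
    refine congrArg Matrix.det (Matrix.ext fun r s => ?_)
    subst h
    simp only [Matrix.reindex_apply, Matrix.submatrix_apply, Matrix.of_apply,
      Equiv.addRight_symm, Equiv.coe_addRight]
    refine Fintype.sum_congr _ _ fun t => Fintype.sum_congr _ _ fun c => ?_
    ring_nf
  have n11 : (1 - 1 : ZMod 3) = 0 := by decide
  have n22 : (2 - 2 : ZMod 3) = 0 := by decide
  have n12 : (1 - 2 : ZMod 3) = 2 := by decide
  have n21 : (2 - 1 : ZMod 3) = 1 := by decide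
  have n01 : (0 - 1 : ZMod 3) = 2 := by decide
  have n02 : (0 - 2 : ZMod 3) = 1 := by decide
  have m22 : (2 * 2 : ZMod 3) = 1 := by decide
  have v0 : (0 : ZMod 3).val = 0 := rfl
  have v1 : (1 : ZMod 3).val = 1 := rfl
  have v2 : (2 : ZMod 3).val = 2 := rfl
  have h1 : G 1 0 = cubicForm w (coeff A) := by
    have : ∀ r s : ZMod 3, ∑ t, ∑ c, (A t (r - s) c : Eisenstein) *
        char (1 * c + (0 + 1 * s) * t) = ∑ t, coeff A t (r - s) * char (s * t) := by
      intro r s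
      refine Fintype.sum_congr _ _ fun t => ?_
      rw [coeff_eq_sum, Finset.sum_mul]
      refine Finset.sum_congr rfl fun c _ => ?_
      rw [mul_assoc, ← AddChar.map_add_eq_mul]
      ring_nf
    simp only [hG, this]
    rw [ZMod.det_three, cubicForm]
    simp only [ZMod.sum_univ_three, n11, n22, n12, n21, n01, n02, m22, v0, v1, v2, sub_zero,
      sub_self, mul_zero, mul_one, one_mul, zero_mul, char_zero, char_one, char_two, pow_zero,
      pow_one]
    ring
  have h2 : G 2 0 = star (cubicForm w (coeff A)) := by
    rw [← h1]
    simp only [hG]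
    rw [← starRingEnd_apply, RingHom.map_det]
    congr 1
    ext1 r s
    simp only [RingHom.mapMatrix_apply, Matrix.map_apply, Matrix.of_apply, map_sum, map_mul,
      map_intCast, starRingEnd_apply, star_char]
    refine Fintype.sum_congr _ _ fun t => Fintype.sum_congr _ _ fun c => ?_
    ring_nf
  have h0 : G 0 0 * G 0 1 * G 0 2 =
      abelianForm (fun i j => ((A i j 0 + A i j 1 + A i j 2 : ℤ) : Eisenstein)) := by
    set f : ZMod 3 → ℕ → Eisenstein := fun l j =>
      ((A 0 l 0 + A 0 l 1 + A 0 l 2 : ℤ) : Eisenstein) +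
      ((A 1 l 0 + A 1 l 1 + A 1 l 2 : ℤ) : Eisenstein) * w ^ j +
      ((A 2 l 0 + A 2 l 1 + A 2 l 2 : ℤ) : Eisenstein) * w ^ (2 * j) with hf
    rw [← prod_circulant w_sq_add _ (f 0) (f 1) (f 2) (fun _ => rfl) (fun _ => rfl) (fun _ => rfl)]
    have entry : ∀ (j : ZMod 3) (r s : ZMod 3), ∑ t, ∑ c, (A t (r - s) c : Eisenstein) *
        char (0 * c + (j + 0 * s) * t) = f (r - s) j.val := by
      intro j r s
      have hj : ∀ t, ∀ c, char (0 * c + (j + 0 * s) * t) = char (j * t) := by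
        intro t c; ring_nf
      have h4 : w ^ (2 * 2) = w := by decide
      simp only [hj, hf, ZMod.sum_univ_three]
      obtain rfl | rfl | rfl := ZMod.eq_zero_or_one_or_two j
      all_goals
        simp only [v0, v1, v2, mul_zero, mul_one, one_mul, zero_mul, m22, char_zero, char_one,
          char_two, pow_zero, pow_one, h4]
        push_cast
        ring
    have hG0 : ∀ j : ZMod 3, G 0 j = f 0 j.val ^ 3 + f 1 j.val ^ 3 + f 2 j.val ^ 3 -
        3 * f 0 j.val * f 1 j.val * f 2 j.val := by
      intro j
      simp only [hG, entry]
      rw [ZMod.det_three]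
      simp only [n11, n22, n12, n21, n01, n02, sub_zero, sub_self]
      ring
    rw [hG0, hG0, hG0, v0, v1, v2]
  have hcast : algebraMap ℤ Eisenstein (abelianForm (fun i j => A i j 0 + A i j 1 + A i j 2)) =
      abelianForm (fun i j => ((A i j 0 + A i j 1 + A i j 2 : ℤ) : Eisenstein)) := by
    simp [abelianForm, total, lineForm₁, lineForm₂, lineForm₃, lineForm₄, symm2]
  change ∏ k, ∏ j, G k j = _
  rw [ZMod.prod_univ_three, ZMod.prod_univ_three, ZMod.prod_univ_three, ZMod.prod_univ_three, h0,
    hcast, shift 1 1 1 (by decide), shift 1 2 2 (by decide), shift 2 1 2 (by decide),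
    shift 2 2 1 (by decide), h1, h2]
  ring

/-! ### The cubic form modulo a power of `w - 1` -/

section Congruence

variable {R : Type*} [CommRing R]

/-- The determinant of the circulant matrix with first column `(x, y, z)`. -/
def circForm (x y z : R) : R := x ^ 3 + y ^ 3 + z ^ 3 - 3 * x * y * z

/-- The coefficient of `(w - 1) ^ 2` in `cubicForm`. -/
def secondForm (x y z p q t a b c : R) : R :=
  x ^ 2 * a + y ^ 2 * b + z ^ 2 * c - x * p ^ 2 - y * q ^ 2 - z * t ^ 2 -
    (x * y * c + y * z * a + z * x * b) + (x * q * t + y * t * p + z * p * q)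

/-- Apart from the cubes of the increments, every term of the difference carries `3 * π`, and 3 is a
multiple of `π ^ 2`. -/
theorem circForm_add_mul_sub_dvd {w π : R} (h3 : (3 : R) = -w ^ 2 * π ^ 2) {x y z x' y' z' : R}
    (hx : π ∣ x' - x) (hy : π ∣ y' - y) (hz : π ∣ z' - z) :
    π ^ 3 ∣ circForm x' y' z' - circForm x y z := by
  obtain ⟨a, ha⟩ := hx
  obtain ⟨b, hb⟩ := hy
  obtain ⟨c, hc⟩ := hz
  obtain rfl : x' = x + π * a := by linear_combination ha
  obtain rfl : y' = y + π * b := by linear_combination hb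
  obtain rfl : z' = z + π * c := by linear_combination hc
  have key : circForm (x + π * a) (y + π * b) (z + π * c) - circForm x y z =
      3 * π * (x ^ 2 * a + π * x * a ^ 2 + y ^ 2 * b + π * y * b ^ 2 + z ^ 2 * c + π * z * c ^ 2 -
        (a * y * z + x * b * z + x * y * c + π * (a * b * z + a * y * c + x * b * c) +
          π ^ 2 * a * b * c)) + π ^ 3 * (a ^ 3 + b ^ 3 + c ^ 3) := by
    simp only [circForm]
    ring
  rw [key, h3]
  exact dvd_add (Dvd.dvd.mul_right ⟨-w ^ 2, by ring⟩ _) (dvd_mul_right _ _)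

/-- Expansion of `cubicForm` modulo `(w - 1) ^ 3`. -/
theorem cubicForm_expansion {w : R} (hw : w ^ 2 + w + 1 = 0) (c : ZMod 3 → ZMod 3 → R) :
    (w - 1) ^ 3 ∣ cubicForm w c -
      (circForm (c 0 0 + c 1 0 + c 2 0) (c 0 1 + c 1 1 + c 2 1) (c 0 2 + c 1 2 + c 2 2) +
        (w - 1) ^ 2 * secondForm (c 0 0 + c 1 0 + c 2 0) (c 0 1 + c 1 1 + c 2 1)
          (c 0 2 + c 1 2 + c 2 2) (c 1 0 - w ^ 2 * c 2 0) (c 1 1 - w ^ 2 * c 2 1)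
          (c 1 2 - w ^ 2 * c 2 2) (w ^ 2 * (c 1 0 + c 2 0)) (w ^ 2 * (c 1 1 + c 2 1))
          (w ^ 2 * (c 1 2 + c 2 2))) := by
  have h0 : ∀ j, c 0 j + c 1 j * w ^ (0 : ZMod 3).val + c 2 j * w ^ (2 * 0 : ZMod 3).val =
      c 0 j + c 1 j + c 2 j := by
    intro j
    rw [show (0 : ZMod 3).val = 0 from rfl, show (2 * 0 : ZMod 3).val = 0 from rfl]
    ring
  have h1 : ∀ j, c 0 j + c 1 j * w ^ (1 : ZMod 3).val + c 2 j * w ^ (2 * 1 : ZMod 3).val =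
      c 0 j + c 1 j + c 2 j + (w - 1) * (c 1 j - w ^ 2 * c 2 j) := by
    intro j
    rw [show (1 : ZMod 3).val = 1 from rfl, show (2 * 1 : ZMod 3).val = 2 from rfl]
    linear_combination (w - 1) * c 2 j * hw
  have h2 : ∀ j, c 0 j + c 1 j * w ^ (2 : ZMod 3).val + c 2 j * w ^ (2 * 2 : ZMod 3).val =
      c 0 j + c 1 j + c 2 j - (w - 1) * (c 1 j - w ^ 2 * c 2 j) +
        (w - 1) ^ 2 * (w ^ 2 * (c 1 j + c 2 j)) := by
    intro j
    rw [show (2 : ZMod 3).val = 2 from rfl, show (2 * 2 : ZMod 3).val = 1 from rfl]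
    linear_combination ((w - 1) * (2 - w) * c 1 j + (w - 1) * (1 - w) * c 2 j) * hw
  simp only [cubicForm, h0, h1, h2]
  generalize c 0 0 + c 1 0 + c 2 0 = x
  generalize c 0 1 + c 1 1 + c 2 1 = y
  generalize c 0 2 + c 1 2 + c 2 2 = z
  generalize c 1 0 - w ^ 2 * c 2 0 = p
  generalize c 1 1 - w ^ 2 * c 2 1 = q
  generalize c 1 2 - w ^ 2 * c 2 2 = t
  generalize w ^ 2 * (c 1 0 + c 2 0) = α
  generalize w ^ 2 * (c 1 1 + c 2 1) = β
  generalize w ^ 2 * (c 1 2 + c 2 2) = γ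
  generalize w - 1 = π
  -- The terms linear in `π` cancel; the witness is the exact coefficient of `π ^ 3`.
  refine ⟨x * p * α + y * q * β + z * t * γ - (x * q * γ + y * t * α + z * p * β), ?_⟩
  rw [circForm, secondForm]
  ring

/-- The reduction of `secondForm` at a family of elements of the base ring. -/
def correction (b : ZMod 3 → ZMod 3 → R) : R :=
  secondForm (b 0 0 + b 1 0 + b 2 0) (b 0 1 + b 1 1 + b 2 1) (b 0 2 + b 1 2 + b 2 2)
    (b 1 0 - b 2 0) (b 1 1 - b 2 1) (b 1 2 - b 2 2) (b 1 0 + b 2 0) (b 1 1 + b 2 1)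
    (b 1 2 + b 2 2)

theorem cubicForm_congr {w : R} (hw : w ^ 2 + w + 1 = 0) (b c : ZMod 3 → ZMod 3 → R)
    (h : ∀ i j, w - 1 ∣ c i j - b i j) :
    3 * (w - 1) ∣ cubicForm w c -
      (circForm (b 0 0 + b 1 0 + b 2 0) (b 0 1 + b 1 1 + b 2 1) (b 0 2 + b 1 2 + b 2 2) -
        3 * correction b) := by
  have h3 : (3 : R) = -w ^ 2 * (w - 1) ^ 2 := by
    linear_combination (w ^ 2 - 3 * w + 3) * hw
  have hs (j : ZMod 3) : w - 1 ∣ c 0 j + c 1 j + c 2 j - (b 0 j + b 1 j + b 2 j) := by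
    have := dvd_add (dvd_add (h 0 j) (h 1 j)) (h 2 j)
    convert this using 1
    ring
  have hK : w - 1 ∣ secondForm (c 0 0 + c 1 0 + c 2 0) (c 0 1 + c 1 1 + c 2 1)
          (c 0 2 + c 1 2 + c 2 2) (c 1 0 - w ^ 2 * c 2 0) (c 1 1 - w ^ 2 * c 2 1)
          (c 1 2 - w ^ 2 * c 2 2) (w ^ 2 * (c 1 0 + c 2 0)) (w ^ 2 * (c 1 1 + c 2 1))
          (w ^ 2 * (c 1 2 + c 2 2)) - correction b := by
    rw [← Ideal.mem_span_singleton, ← Ideal.Quotient.eq]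
    have hc (i j) : Ideal.Quotient.mk (Ideal.span {w - 1}) (c i j) =
        Ideal.Quotient.mk (Ideal.span {w - 1}) (b i j) := by
      rw [Ideal.Quotient.eq, Ideal.mem_span_singleton]
      exact h i j
    have hw1 : Ideal.Quotient.mk (Ideal.span {w - 1}) w = 1 := by
      rw [← map_one (Ideal.Quotient.mk (Ideal.span {w - 1})), Ideal.Quotient.eq,
        Ideal.mem_span_singleton]
    simp only [correction, secondForm, map_add, map_sub, map_mul, map_pow, hc, hw1, one_pow,
      one_mul]
  obtain ⟨u, hu⟩ := cubicForm_expansion hw c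
  obtain ⟨v, hv⟩ := circForm_add_mul_sub_dvd h3 (hs 0) (hs 1) (hs 2)
  obtain ⟨k, hk⟩ := hK
  -- This uses `(w - 1) ^ 2 = -3 * w`, which also turns the quadratic term into `-3 * correction b`
  -- modulo `3 * (w - 1)`.
  refine ⟨-w * (u + v + k) - correction b, ?_⟩
  linear_combination hu + hv + (w - 1) ^ 2 * hk + ((w - 1) * (u + v + k) + correction b) * hw

end Congruence

/-- The cross term is `3 * U` times the trace of a multiple of `w - 1`, and such traces are
divisible by 3. -/
theorem Eisenstein.norm_sub_sq_dvd (d : Eisenstein) (U : ℤ) (h : 3 * (w - 1) ∣ d - (U : Eisenstein)) :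
    9 ∣ d.norm - U ^ 2 := by
  obtain ⟨k, hk⟩ := h
  have hre := congrArg QuadraticAlgebra.re hk
  have him := congrArg QuadraticAlgebra.im hk
  simp [w, QuadraticAlgebra.re_one, QuadraticAlgebra.im_one, QuadraticAlgebra.re_ofNat,
    QuadraticAlgebra.im_ofNat] at hre him
  rw [QuadraticAlgebra.norm_def]
  obtain ⟨x, y⟩ := d
  obtain ⟨u, v⟩ := k
  simp only at hre him ⊢
  obtain rfl : x = U - 3 * u - 3 * v := by linear_combination hre
  obtain rfl : y = 3 * u - 6 * v := by linear_combination him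
  exact ⟨3 * u ^ 2 - 3 * u * v - U * u + 3 * v ^ 2, by ring⟩

theorem Eisenstein.norm_cubicForm_dvd (A : ZMod 3 → ZMod 3 → ZMod 3 → ℤ)
    (b : ZMod 3 → ZMod 3 → ℤ) (hb : ∀ i j, b i j = A i j 0 + A i j 1 + A i j 2) :
    9 ∣ (cubicForm w (coeff A)).norm -
      (total b ^ 3 - 3 * (total b * lineForm₁ b + correction b)) ^ 2 := by
  apply Eisenstein.norm_sub_sq_dvd
  have := cubicForm_congr w_sq_add (fun i j => (b i j : Eisenstein)) (coeff A) (by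
    intro i j
    -- The quotient is `A₁ + A₂ (w + 1)`, from `w ^ 2 - 1 = (w - 1) (w + 1)`.
    refine ⟨⟨A i j 1 + A i j 2, A i j 2⟩, ?_⟩
    ext <;> simp [w, coeff, hb, QuadraticAlgebra.re_one, QuadraticAlgebra.im_one] <;> ring)
  convert this using 2
  simp only [total, lineForm₁, circForm, symm2, correction, secondForm]
  push_cast
  ring

/-! ### Relations between the line forms, and the congruence modulo 27 -/

/-- The sum of the products of pairs of entries. -/
def pairForm (b : ZMod 3 → ZMod 3 → ℤ) : ℤ :=
  b 0 0 * (b 1 0 + b 2 0 + b 0 1 + b 1 1 + b 2 1 + b 0 2 + b 1 2 + b 2 2) +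
  b 1 0 * (b 2 0 + b 0 1 + b 1 1 + b 2 1 + b 0 2 + b 1 2 + b 2 2) +
  b 2 0 * (b 0 1 + b 1 1 + b 2 1 + b 0 2 + b 1 2 + b 2 2) +
  b 0 1 * (b 1 1 + b 2 1 + b 0 2 + b 1 2 + b 2 2) +
  b 1 1 * (b 2 1 + b 0 2 + b 1 2 + b 2 2) + b 2 1 * (b 0 2 + b 1 2 + b 2 2) +
  b 0 2 * (b 1 2 + b 2 2) + b 1 2 * b 2 2

/-- Two distinct points of the affine plane share a line in exactly one of the four directions, so
the other three each count their product. -/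
theorem sum_lineForm (b : ZMod 3 → ZMod 3 → ℤ) :
    lineForm₁ b + lineForm₂ b + lineForm₃ b + lineForm₄ b = 3 * pairForm b := by
  simp only [lineForm₁, lineForm₂, lineForm₃, lineForm₄, symm2, pairForm]
  ring

/-- The second elementary symmetric polynomial in the four forms `lineForm`. -/
def lineSymm2 (b : ZMod 3 → ZMod 3 → ℤ) : ℤ :=
  lineForm₁ b * lineForm₂ b + lineForm₁ b * lineForm₃ b + lineForm₁ b * lineForm₄ b +
    lineForm₂ b * lineForm₃ b + lineForm₂ b * lineForm₄ b + lineForm₃ b * lineForm₄ b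

/-- This relation links the abelian and cubic factors: it makes their contributions of order 9
cancel modulo 27. -/
theorem lineSymm2_congr (b : ZMod 3 → ZMod 3 → ℤ) :
    3 ∣ lineSymm2 b - total b ^ 2 * pairForm b -
      2 * total b * (total b * lineForm₁ b + correction b) := by
  rw [← Nat.cast_ofNat (n := 3), ← ZMod.intCast_zmod_eq_zero_iff_dvd]
  simp only [lineSymm2, total, pairForm, lineForm₁, lineForm₂, lineForm₃, lineForm₄, correction,
    secondForm, symm2]
  push_cast
  generalize (b 0 0 : ZMod 3) = b00, (b 1 0 : ZMod 3) = b10, (b 2 0 : ZMod 3) = b20,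
    (b 0 1 : ZMod 3) = b01, (b 1 1 : ZMod 3) = b11, (b 2 1 : ZMod 3) = b21,
    (b 0 2 : ZMod 3) = b02, (b 1 2 : ZMod 3) = b12, (b 2 2 : ZMod 3) = b22
  grind

/-- With `v = s * e₁ + K`, modulo 27 the first factor is `s ^ 9 + 9 s ^ 5 (σ - s ^ 2 E)` and `n ^ 3`
is `s ^ 18 - 18 s ^ 15 v`. The product is `s ^ 27 + 9 s ^ 23 (σ - s ^ 2 E - 2 s v)`, whose bracket
is divisible by 3 by `h`. -/
theorem groupDet_congr_pow (s e₁ e₂ e₃ e₄ E K n σ : ℤ) (hE : e₁ + e₂ + e₃ + e₄ = 3 * E)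
    (hσ : σ = e₁ * e₂ + e₁ * e₃ + e₁ * e₄ + e₂ * e₃ + e₂ * e₄ + e₃ * e₄)
    (h : 3 ∣ σ - s ^ 2 * E - 2 * s * (s * e₁ + K))
    (hn : 9 ∣ n - (s ^ 3 - 3 * (s * e₁ + K)) ^ 2) :
    s * ((s ^ 2 - 3 * e₁) * (s ^ 2 - 3 * e₂) * (s ^ 2 - 3 * e₃) * (s ^ 2 - 3 * e₄)) * n ^ 3 ≡
      s ^ 27 [ZMOD 27] := by
  obtain ⟨W, hW⟩ := h
  obtain ⟨m, hm⟩ := hn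
  generalize s * e₁ + K = v at hW hm
  obtain ⟨β, hβ⟩ : ∃ β, s * ((s ^ 2 - 3 * e₁) * (s ^ 2 - 3 * e₂) * (s ^ 2 - 3 * e₃) *
      (s ^ 2 - 3 * e₄)) = s ^ 9 + 9 * (s ^ 5 * (σ - s ^ 2 * E)) + 27 * β :=
    ⟨-s ^ 3 * (e₁ * e₂ * e₃ + e₁ * e₂ * e₄ + e₁ * e₃ * e₄ + e₂ * e₃ * e₄) +
      3 * s * e₁ * e₂ * e₃ * e₄, by
      rw [hσ]; linear_combination -3 * s ^ 7 * hE⟩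
  obtain ⟨γ, hγ⟩ : ∃ γ, n ^ 3 = s ^ 18 - 18 * (s ^ 15 * v) + 27 * γ := by
    obtain rfl : n = (s ^ 3 - 3 * v) ^ 2 + 9 * m := by linear_combination hm
    exact ⟨5 * s ^ 12 * v ^ 2 - 20 * s ^ 9 * v ^ 3 + 45 * s ^ 6 * v ^ 4 - 54 * s ^ 3 * v ^ 5 +
      27 * v ^ 6 + (s ^ 3 - 3 * v) ^ 4 * m + 9 * (s ^ 3 - 3 * v) ^ 2 * m ^ 2 + 27 * m ^ 3, by ring⟩
  rw [hβ, hγ]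
  apply Int.ModEq.symm
  rw [Int.modEq_iff_dvd]
  refine ⟨s ^ 23 * W - 6 * s ^ 20 * (σ - s ^ 2 * E) * v + β * n ^ 3 + γ * s ^ 9 +
    9 * γ * s ^ 5 * (σ - s ^ 2 * E), ?_⟩
  rw [hγ]
  linear_combination 9 * s ^ 23 * hW

/-! ### Divisibility by `3 ^ 12` -/

/-- Substituting `r = -p - q` gives `-(p - q) ^ 2` in characteristic 3. -/
theorem symm2_zmod_of_sum_eq_zero (p q r : ZMod 3) (h : p + q + r = 0) :
    symm2 p q r = 0 ∨ symm2 p q r = 2 := by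
  revert p q r
  unfold symm2
  decide

/-- Four values all equal to `2 = -1` would sum to `-4 ≠ 0`. -/
theorem prod_eq_zero_of_sum_eq_zero (e₁ e₂ e₃ e₄ : ZMod 3) (h₁ : e₁ = 0 ∨ e₁ = 2)
    (h₂ : e₂ = 0 ∨ e₂ = 2) (h₃ : e₃ = 0 ∨ e₃ = 2) (h₄ : e₄ = 0 ∨ e₄ = 2)
    (h : e₁ + e₂ + e₃ + e₄ = 0) : e₁ * e₂ * e₃ * e₄ = 0 := by
  obtain rfl | rfl := h₁
  · simp
  obtain rfl | rfl := h₂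
  · simp
  obtain rfl | rfl := h₃
  · simp
  obtain rfl | rfl := h₄
  · simp
  · exact absurd h (by decide)

theorem three_dvd_prod_lineForm (b : ZMod 3 → ZMod 3 → ℤ) (h : 3 ∣ total b) :
    3 ∣ lineForm₁ b * lineForm₂ b * lineForm₃ b * lineForm₄ b := by
  have hs := congrArg (Int.cast : ℤ → ZMod 3) (sum_lineForm b)
  rw [← Nat.cast_ofNat (n := 3), ← ZMod.intCast_zmod_eq_zero_iff_dvd] at h ⊢
  push_cast at hs ⊢
  rw [show (3 : ZMod 3) = 0 from rfl, zero_mul] at hs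
  simp only [total] at h
  push_cast at h
  refine prod_eq_zero_of_sum_eq_zero _ _ _ _ ?_ ?_ ?_ ?_ hs <;>
    simp only [lineForm₁, lineForm₂, lineForm₃, lineForm₄, symm2] <;> push_cast <;>
    refine symm2_zmod_of_sum_eq_zero _ _ _ ?_ <;> linear_combination h

theorem groupDet_heisenberg_congr (A : ZMod 3 → ZMod 3 → ZMod 3 → ℤ) (b : ZMod 3 → ZMod 3 → ℤ)
    (hb : ∀ i j, b i j = A i j 0 + A i j 1 + A i j 2) :
    abelianForm b * (cubicForm w (coeff A)).norm ^ 3 ≡ total b ^ 27 [ZMOD 27] :=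
  groupDet_congr_pow _ _ _ _ _ _ _ _ _ (sum_lineForm b) rfl (lineSymm2_congr b)
    (norm_cubicForm_dvd A b hb)

theorem pow_twelve_dvd (A : ZMod 3 → ZMod 3 → ZMod 3 → ℤ) (b : ZMod 3 → ZMod 3 → ℤ)
    (hb : ∀ i j, b i j = A i j 0 + A i j 1 + A i j 2) (h : 3 ∣ total b) :
    3 ^ 12 ∣ abelianForm b * (cubicForm w (coeff A)).norm ^ 3 := by
  have h9 : (3 ^ 2 : ℤ) ∣ (cubicForm w (coeff A)).norm := by
    have h3 : (3 : ℤ) ∣ total b ^ 3 - 3 * (total b * lineForm₁ b + correction b) :=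
      dvd_sub (dvd_pow h three_ne_zero) (dvd_mul_right _ _)
    have := dvd_add (norm_cubicForm_dvd A b hb) (pow_dvd_pow_of_dvd h3 2)
    rwa [sub_add_cancel] at this
  have h6 : (3 ^ 6 : ℤ) ∣ abelianForm b := by
    obtain ⟨t, ht⟩ := three_dvd_prod_lineForm b h
    obtain ⟨s, hs⟩ := h
    rw [abelianForm, hs]
    -- With total `3 * s`, the form is `3 ^ 5 * s * ∏ (3 * s ^ 2 - eᵢ)`; the sixth factor 3 comes
    -- from `3 ∣ e₁ e₂ e₃ e₄`.
    refine ⟨s * (27 * s ^ 8 - 9 * s ^ 6 * (lineForm₁ b + lineForm₂ b + lineForm₃ b + lineForm₄ b) +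
      3 * s ^ 4 * lineSymm2 b -
      s ^ 2 * (lineForm₁ b * lineForm₂ b * lineForm₃ b + lineForm₁ b * lineForm₂ b * lineForm₄ b +
        lineForm₁ b * lineForm₃ b * lineForm₄ b + lineForm₂ b * lineForm₃ b * lineForm₄ b) + t), ?_⟩
    rw [lineSymm2]
    linear_combination 243 * s * ht
  have := mul_dvd_mul h6 (pow_dvd_pow_of_dvd h9 3)
  rwa [← pow_mul, ← pow_add] at this

/-! ### Realizing the values -/

/-- The array `v` with the constant `m` added to every entry. -/
def shifted (v : Fin 3 → Fin 3 → Fin 3 → ℤ) (m : ℤ) : ZMod 3 → ZMod 3 → ZMod 3 → ℤ :=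
  fun i j k => v i j k + m

theorem coeff_shifted (v : Fin 3 → Fin 3 → Fin 3 → ℤ) (m : ℤ) :
    coeff (shifted v m) = coeff v := by
  funext i j
  simp only [coeff, shifted, add_sub_add_right_eq_sub]

theorem abelianForm_add_const (b : ZMod 3 → ZMod 3 → ℤ) (s m q : ℤ) (hs : total b = s)
    (hq : (s ^ 2 - 3 * lineForm₁ b) * (s ^ 2 - 3 * lineForm₂ b) *
      (s ^ 2 - 3 * lineForm₃ b) * (s ^ 2 - 3 * lineForm₄ b) = q) :
    abelianForm (fun i j => b i j + m) = (s + 9 * m) * q := by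
  subst hs
  rw [← hq, abelianForm]
  have h0 : total (fun i j => b i j + m) = total b + 9 * m := by simp only [total]; ring
  rw [h0]
  have h1 : (total b + 9 * m) ^ 2 - 3 * lineForm₁ (fun i j => b i j + m) =
      total b ^ 2 - 3 * lineForm₁ b := by simp only [total, lineForm₁, symm2]; ring
  have h2 : (total b + 9 * m) ^ 2 - 3 * lineForm₂ (fun i j => b i j + m) =
      total b ^ 2 - 3 * lineForm₂ b := by simp only [total, lineForm₂, symm2]; ring
  have h3 : (total b + 9 * m) ^ 2 - 3 * lineForm₃ (fun i j => b i j + m) =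
      total b ^ 2 - 3 * lineForm₃ b := by simp only [total, lineForm₃, symm2]; ring
  have h4 : (total b + 9 * m) ^ 2 - 3 * lineForm₄ (fun i j => b i j + m) =
      total b ^ 2 - 3 * lineForm₄ b := by simp only [total, lineForm₄, symm2]; ring
  rw [h1, h2, h3, h4]

/-- Nontrivial irreducible representations do not see a constant added to all 27 entries. The
hypotheses are closed computations for an explicit `v`. -/
theorem groupDet_shifted (v : Fin 3 → Fin 3 → Fin 3 → ℤ) (s q n m : ℤ)
    (hs : total (fun i j : ZMod 3 => v i j 0 + v i j 1 + v i j 2) = s)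
    (hq : (s ^ 2 - 3 * lineForm₁ (fun i j : ZMod 3 => v i j 0 + v i j 1 + v i j 2)) *
      (s ^ 2 - 3 * lineForm₂ (fun i j : ZMod 3 => v i j 0 + v i j 1 + v i j 2)) *
      (s ^ 2 - 3 * lineForm₃ (fun i j : ZMod 3 => v i j 0 + v i j 1 + v i j 2)) *
      (s ^ 2 - 3 * lineForm₄ (fun i j : ZMod 3 => v i j 0 + v i j 1 + v i j 2)) = q)
    (hn : (cubicForm w (coeff v)).norm = n) :
    (s + 27 * m) * q * n ^ 3 ∈ groupDetValues (heisenberg (ZMod 3)) := by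
  refine ⟨_, (groupDet_heisenberg (shifted v m)).trans ?_⟩
  rw [coeff_shifted, hn]
  -- Each coset sum has three entries, hence moves by `3 * m`.
  have := abelianForm_add_const _ s (3 * m) q hs hq
  rw [show s + 27 * m = s + 9 * (3 * m) by ring, ← this]
  congr 2
  funext i j
  simp only [shifted]
  ring!

theorem neg_mem_groupDetValues {m : ℤ} (h : m ∈ groupDetValues (heisenberg (ZMod 3))) :
    -m ∈ groupDetValues (heisenberg (ZMod 3)) := by
  obtain ⟨a, rfl⟩ := h
  refine ⟨-a, ?_⟩
  have h27 : Fintype.card (heisenberg (ZMod 3)) = 27 := by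
    rw [Fintype.card_congr (heisenbergEquiv (ZMod 3))]
    simp [ZMod.card]
  rw [groupDet, groupDet, show (Matrix.of fun g h : heisenberg (ZMod 3) => (-a) (g * h⁻¹)) =
    -Matrix.of fun g h : heisenberg (ZMod 3) => a (g * h⁻¹) from rfl, Matrix.det_neg, h27]
  norm_num

/-- In this and the next four arrays the factors other than the total contribute `243 * 9 ^ 3 = 3 ^
11`, and the total is 3 times the residue sought modulo 9. -/
theorem mem_groupDetValues_zero (m : ℤ) :
    3 ^ 12 * (9 * m) ∈ groupDetValues (heisenberg (ZMod 3)) := by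
  have := groupDet_shifted ![![![0, -1, 0], ![1, 0, -1], ![0, 0, 0]],
    ![![0, 1, -1], ![0, 0, 0], ![0, -1, 0]], ![![0, 0, 1], ![0, 0, 1], ![0, 0, 0]]]
    0 243 9 m (by decide) (by decide) (by decide)
  convert this using 1
  ring

theorem mem_groupDetValues_one (m : ℤ) :
    3 ^ 12 * (1 + 9 * m) ∈ groupDetValues (heisenberg (ZMod 3)) := by
  have := groupDet_shifted ![![![1, 0, 0], ![0, -1, 0], ![-1, 1, 0]],
    ![![0, 1, 0], ![0, 0, 0], ![1, 1, -1]], ![![1, 0, -1], ![0, 0, 0], ![0, 0, 1]]]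
    3 243 9 m (by decide) (by decide) (by decide)
  convert this using 1
  ring

theorem mem_groupDetValues_two (m : ℤ) :
    3 ^ 12 * (2 + 9 * m) ∈ groupDetValues (heisenberg (ZMod 3)) := by
  have := groupDet_shifted ![![![0, 1, -1], ![1, 0, 0], ![0, -1, 1]],
    ![![0, 0, 1], ![1, 0, 0], ![0, 0, 1]], ![![0, -1, 1], ![1, 1, 0], ![-1, 1, 0]]]
    6 243 9 m (by decide) (by decide) (by decide)
  convert this using 1
  ring

theorem mem_groupDetValues_three (m : ℤ) :
    3 ^ 12 * (3 + 9 * m) ∈ groupDetValues (heisenberg (ZMod 3)) := by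
  have := groupDet_shifted ![![![1, 1, 0], ![1, 0, 1], ![0, 0, 1]],
    ![![-1, 0, 1], ![0, 1, 0], ![1, 0, 0]], ![![1, 0, -1], ![1, -1, 1], ![-1, 1, 1]]]
    9 243 9 m (by decide) (by decide) (by decide)
  convert this using 1
  ring

theorem mem_groupDetValues_five (m : ℤ) :
    3 ^ 12 * (5 + 9 * m) ∈ groupDetValues (heisenberg (ZMod 3)) := by
  have := groupDet_shifted ![![![1, 1, 0], ![1, 1, 0], ![0, 1, 1]],
    ![![1, 0, 0], ![1, 0, 0], ![1, 1, 0]], ![![0, 0, 1], ![1, 1, 1], ![0, 0, 1]]]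
    15 243 9 m (by decide) (by decide) (by decide)
  convert this using 1
  ring

theorem pow_twelve_mul_mem_groupDetValues (k : ℤ) :
    3 ^ 12 * k ∈ groupDetValues (heisenberg (ZMod 3)) := by
  obtain ⟨m, h⟩ : ∃ m, k = 9 * m ∨ k = 1 + 9 * m ∨ k = 2 + 9 * m ∨ k = 3 + 9 * m ∨
      k = -(5 + 9 * m) ∨ k = 5 + 9 * m ∨ k = -(3 + 9 * m) ∨ k = -(2 + 9 * m) ∨
      k = -(1 + 9 * m) := by
    -- The residues 4, 6, 7, 8 are the negatives of 5, 3, 2, 1 modulo 9.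
    obtain h | h : 0 ≤ k % 9 ∧ k % 9 ≤ 3 ∨ k % 9 = 5 ∨ k % 9 = 4 ∨ 6 ≤ k % 9 := by omega
    · exact ⟨k / 9, by omega⟩
    · obtain h | h := h
      · exact ⟨k / 9, by omega⟩
      · exact ⟨-(k / 9) - 1, by omega⟩
  obtain rfl | rfl | rfl | rfl | rfl | rfl | rfl | rfl | rfl := h
  · exact mem_groupDetValues_zero m
  · exact mem_groupDetValues_one m
  · exact mem_groupDetValues_two m
  · exact mem_groupDetValues_three m
  · exact mul_neg (3 ^ 12 : ℤ) _ ▸ neg_mem_groupDetValues (mem_groupDetValues_five m)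
  · exact mem_groupDetValues_five m
  · exact mul_neg (3 ^ 12 : ℤ) _ ▸ neg_mem_groupDetValues (mem_groupDetValues_three m)
  · exact mul_neg (3 ^ 12 : ℤ) _ ▸ neg_mem_groupDetValues (mem_groupDetValues_two m)
  · exact mul_neg (3 ^ 12 : ℤ) _ ▸ neg_mem_groupDetValues (mem_groupDetValues_one m)

theorem one_add_mul_mem_groupDetValues (m : ℤ) :
    1 + 27 * m ∈ groupDetValues (heisenberg (ZMod 3)) := by
  have := groupDet_shifted ![![![1, 0, 0], ![0, 0, 0], ![0, 0, 0]],
    ![![0, 0, 0], ![0, 0, 0], ![0, 0, 0]], ![![0, 0, 0], ![0, 0, 0], ![0, 0, 0]]]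
    1 1 1 m (by decide) (by decide) (by decide)
  convert this using 1
  ring

/-! ### Conclusion -/

theorem Int.pow_twentySeven_modEq (s : ℤ) :
    s ^ 27 ≡ 0 [ZMOD 27] ∨ s ^ 27 ≡ 1 [ZMOD 27] ∨ s ^ 27 ≡ -1 [ZMOD 27] := by
  have h : ∀ x : ZMod 27, x ^ 27 = 0 ∨ x ^ 27 = 1 ∨ x ^ 27 = -1 := by decide
  have hs := h s
  rw [← Int.cast_one, ← Int.cast_zero, ← Int.cast_neg, ← Int.cast_pow] at hs
  exact_mod_cast hs.imp (ZMod.intCast_eq_intCast_iff _ _ 27).mp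
    (Or.imp (ZMod.intCast_eq_intCast_iff _ _ 27).mp (ZMod.intCast_eq_intCast_iff _ _ 27).mp)

theorem exists_groupDet_eq {m : ℤ} (h : m ∈ groupDetValues (heisenberg (ZMod 3))) :
    ∃ A : ZMod 3 → ZMod 3 → ZMod 3 → ℤ,
      m = abelianForm (fun i j => A i j 0 + A i j 1 + A i j 2) *
        (cubicForm w (coeff A)).norm ^ 3 := by
  obtain ⟨a, rfl⟩ := h
  have h := groupDet_heisenberg fun i j k => a ((heisenbergEquiv (ZMod 3)).symm (i, j, k))
  have ha : (fun g : heisenberg (ZMod 3) =>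
      a ((heisenbergEquiv (ZMod 3)).symm (g.1.1 0 1, g.1.1 1 2, g.1.1 0 2))) = a :=
    funext fun g => congrArg a ((heisenbergEquiv (ZMod 3)).symm_apply_apply g)
  refine ⟨fun i j k => a ((heisenbergEquiv (ZMod 3)).symm (i, j, k)), ?_⟩
  rw [← h]
  exact congrArg (groupDet (heisenberg (ZMod 3))) ha.symm

theorem modEq_of_mem_groupDetValues {m : ℤ} (h : m ∈ groupDetValues (heisenberg (ZMod 3)))
    (h3 : ¬ 3 ∣ m) : m ≡ 1 [ZMOD 27] ∨ m ≡ -1 [ZMOD 27] := by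
  obtain ⟨A, rfl⟩ := exists_groupDet_eq h
  have hc := groupDet_heisenberg_congr A _ fun _ _ => rfl
  obtain h0 | h1 | h1 := Int.pow_twentySeven_modEq
    (total fun i j => A i j 0 + A i j 1 + A i j 2)
  · exact absurd ((show (3 : ℤ) ∣ 27 by norm_num).trans
      (Int.modEq_zero_iff_dvd.mp (hc.trans h0))) h3
  · exact Or.inl (hc.trans h1)
  · exact Or.inr (hc.trans h1)

theorem pow_twelve_dvd_of_mem_groupDetValues {m : ℤ}
    (h : m ∈ groupDetValues (heisenberg (ZMod 3))) (h3 : 3 ∣ m) : 3 ^ 12 ∣ m := by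
  obtain ⟨A, rfl⟩ := exists_groupDet_eq h
  refine pow_twelve_dvd A _ (fun _ _ => rfl) ?_
  -- The determinant is `s ^ 27` modulo 3, so `3 ∣ m` forces 3 to divide the total `s`.
  have hc := (groupDet_heisenberg_congr A _ fun _ _ => rfl).of_dvd
    (show (3 : ℤ) ∣ 27 by norm_num)
  exact Int.prime_three.dvd_of_dvd_pow
    (Int.modEq_zero_iff_dvd.mp (hc.symm.trans (Int.modEq_zero_iff_dvd.mpr h3)))

theorem theorem3p5 :
    groupDetValuesOne 3 (heisenberg (ZMod 3)) = {m : ℤ | m ≡ 1 [ZMOD 27] ∨ m ≡ -1 [ZMOD 27]} ∧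
    groupDetValuesZero 3 (heisenberg (ZMod 3)) = {m : ℤ | ∃ k : ℤ, m = 3 ^ 12 * k} := by
  constructor
  · ext m
    constructor
    · rintro ⟨hm, hc⟩
      refine modEq_of_mem_groupDetValues hm fun h => ?_
      exact Int.prime_three.not_isUnit (hc.isUnit_of_dvd' h dvd_rfl)
    · intro h
      obtain ⟨k, hk⟩ : ∃ k, m = 1 + 27 * k ∨ m = -(1 + 27 * k) := by
        obtain h | h := h
        · exact ⟨m / 27, by unfold Int.ModEq at h; omega⟩
        · exact ⟨-m / 27, by unfold Int.ModEq at h; omega⟩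
      constructor
      · obtain rfl | rfl := hk
        · exact one_add_mul_mem_groupDetValues k
        · exact neg_mem_groupDetValues (one_add_mul_mem_groupDetValues k)
      · obtain rfl | rfl := hk
        · exact ⟨1, -9 * k, by push_cast; ring⟩
        · exact ⟨-1, -9 * k, by push_cast; ring⟩
  · ext m
    constructor
    · rintro ⟨hm, h3⟩
      exact pow_twelve_dvd_of_mem_groupDetValues hm h3
    · rintro ⟨k, rfl⟩
      exact ⟨pow_twelve_mul_mem_groupDetValues k, Dvd.dvd.mul_right (by norm_num) k⟩
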